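/- Let $\kappa$ be a cardinal that is not both singular and the least $\mathcal L_{\omega_1\omega}$-compact cardinal. Then the following are equivalent: 1. $\kappa$ is $\mathcal L_{\omega_1\omega}$-compact, i.e. every (proper) $\kappa$-complete filter on any set $I$ can be extended to an $\omega_1$-complete ultrafilter on $I$. (For a cardinal $\mu$, a filter is $\mu$-complete if it is closed under intersections of fewer than $\mu$ of its members.) 2. $\kappa\in\mathcal{WS}$, i.e. for every set $X$ of variables, every nonempty system $S$ of homogeneous $\mathbb Z$-linear equations in variables from $X$ has a weakly nontrivial solution in $\mathbb Z$, provided that each nonempty subsystem $T\subseteq S$ of cardinality $<\kappa$ has one. Here a homogeneous $\mathbb Z$-linear equation in variables from $X$ is an equation $\sum_{x\in X} a_x x=0$ with $a_x\in\mathbb Z$, only finitely many of them nonzero; the variable $x$ appears in it if $a_x\neq 0$. A weakly nontrivial solution in $\mathbb Z$ of a nonempty system $S$ is a map $f\colon X\to\mathbb Z$ such that $\sum_{x} a_x f(x)=0$ for every equation $\sum_x a_x x=0$ in $S$, and $f(x)\neq 0$ for at least one variable $x$ that appears in some equation of $S$. -/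

import Mathlib

open Cardinal

universe u

/-- For an uncountable cardinal `ν`, a cardinal `κ` is `L_{νω}`-compact if every (proper)
`κ`-complete filter on any set `I` can be extended to a `ν`-complete ultrafilter. Here `κ`-complete
means closed under intersections of fewer than `κ` members; in Mathlib's order on filters `U ≤ F`
means that `U` contains every member of `F`. -/
def IsLCompact (ν κ : Cardinal.{u}) : Prop :=
  ∀ (I : Type u) (F : Filter I), F.NeBot → CardinalInterFilter F κ →
    ∃ U : Ultrafilter I, (U : Filter I) ≤ F ∧ CardinalInterFilter (U : Filter I) ν

/-- A homogeneous `ℤ`-linear equation `∑ a_x x = 0` in variables from `X`, given by its finitely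
supported family of integer coefficients. -/
abbrev HomEquation (X : Type u) : Type u := X →₀ ℤ

/-- The assignment `f : X → H` satisfies every equation of the system `S`. -/
def IsSolution {X : Type u} {H : Type*} [AddCommGroup H] (S : Set (HomEquation X))
    (f : X → H) : Prop :=
  ∀ k ∈ S, k.sum (fun x a => a • f x) = 0

/-- The set of variables which appear in (some equation of) the system `S`. -/
def variablesOf {X : Type u} (S : Set (HomEquation X)) : Set X :=
  {x | ∃ k ∈ S, x ∈ k.support}

/-- The system `S` is weakly nontrivially solvable in the abelian group `H`: it has a solution which
is not constantly zero on the variables that appear in `S`. By convention the empty system is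
weakly nontrivially solvable. -/
def WeaklyNontriviallySolvable {X : Type u} (H : Type*) [AddCommGroup H]
    (S : Set (HomEquation X)) : Prop :=
  ∃ f : X → H, IsSolution S f ∧ (S.Nonempty → ∃ x ∈ variablesOf S, f x ≠ 0)

/-- `κ ∈ WS`: every nonempty system of homogeneous `ℤ`-linear equations has a weakly nontrivial
solution in `ℤ` whenever each of its nonempty subsystems of cardinality `< κ` has one. -/
def InWS (κ : Cardinal.{u}) : Prop :=
  ∀ (X : Type u) (S : Set (HomEquation X)), S.Nonempty →
    (∀ T ⊆ S, T.Nonempty → #T < κ → WeaklyNontriviallySolvable ℤ T) →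
    WeaklyNontriviallySolvable ℤ S

/-! The two halves of the equivalence pass through homomorphisms `ℤ^I → ℤ` and through limits along
`ω₁`-complete ultrafilters.

From `κ ∈ WS` to compactness, for every `κ`. Given a `κ`-complete proper filter `F` on `I`, the
system `relationSystem F` collects the `ℤ`-linear relations modulo `F` between functions `I → ℤ`.
Fewer than `κ` of these relations hold simultaneously at `F`-almost every point, so that evaluation
at a suitable point is a weakly nontrivial solution. A weakly nontrivial solution of the whole
system is a nonzero homomorphism `φ : ℤ^I → ℤ` that depends only on values modulo `F`. By Specker's
theorem on homomorphisms `ℤ^ℕ → ℤ` (`map_eq_zero_of_map_single_eq_zero` and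
`exists_map_single_eq_zero`), the sets on which `φ` vanishes form a `σ`-ideal
(`IsNullFor.iUnion`) with no infinite partition into positive sets, hence with an atom
(`IsNullFor.exists_atom`). The sets that are co-null in an atom form the desired ultrafilter.

From compactness to `κ ∈ WS`. A compact cardinal is uncountable, both properties pass to larger
cardinals, and a singular compact cardinal that is not the least one lies above the successor of a
smaller compact cardinal; hence `κ` may be assumed regular and uncountable. Then a closing-off
argument (`exists_variable_ne_zero`) gives one variable at which all small subsystems have
nonvanishing solutions. The `κ`-complete filter generated by the cones of small subsystems extends
to an `ω₁`-complete ultrafilter, and integer-valued families have limits along it; the limit of the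
solutions solves the whole system and does not vanish at the chosen variable. -/

open Filter

/-! ### Homomorphisms from the Baer–Specker group -/

/-- Modulo `d`, a homomorphism on `ℤ^ℕ` sees only the terms before the index from which on `d`
divides all terms. -/
theorem dvd_map_sub_sum (ψ : (ℕ → ℤ) →+ ℤ) {d : ℤ} {m : ℕ} {c : ℕ → ℤ}
    (h : ∀ n, m ≤ n → d ∣ c n) :
    d ∣ ψ c - ∑ i ∈ Finset.range m, c i * ψ (Pi.single i 1) := by
  choose! q hq using h
  have hc : c = ∑ i ∈ Finset.range m, c i • (Pi.single i 1 : ℕ → ℤ)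
      + d • fun n => if m ≤ n then q n else 0 := by
    funext n
    simp only [Pi.add_apply, Finset.sum_apply, Pi.smul_apply, Pi.single_apply, smul_eq_mul,
      mul_ite, mul_one, mul_zero, Finset.sum_ite_eq, Finset.mem_range]
    by_cases hn : m ≤ n
    · simp [hn, hq n hn]
    · simp [hn, not_le.1 hn]
  have hψ := congrArg ψ hc
  rw [map_add, map_sum, map_zsmul] at hψ
  simp only [map_zsmul, smul_eq_mul] at hψ
  rw [hψ, add_sub_cancel_left]
  exact dvd_mul_right _ _

theorem map_eq_zero_of_pow_dvd (ψ : (ℕ → ℤ) →+ ℤ) (h : ∀ n, ψ (Pi.single n 1) = 0) {p : ℤ}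
    (hp : 1 < p) {c : ℕ → ℤ} (hc : ∀ n, p ^ n ∣ c n) : ψ c = 0 := by
  have hdvd (m : ℕ) : p ^ m ∣ ψ c := by
    simpa [h] using dvd_map_sub_sum ψ fun n (hn : m ≤ n) => (pow_dvd_pow p hn).trans (hc n)
  by_contra hne
  obtain ⟨n, hn⟩ := pow_unbounded_of_one_lt |ψ c| hp
  exact hne (Int.eq_zero_of_abs_lt_dvd (hdvd n) hn)

/-- Specker's theorem, first half: a homomorphism `ℤ^ℕ → ℤ` vanishing on the unit vectors is zero.
Every sequence is the sum of one whose `n`-th term is divisible by `2 ^ n` and one whose `n`-th term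
is divisible by `3 ^ n`. -/
theorem map_eq_zero_of_map_single_eq_zero (ψ : (ℕ → ℤ) →+ ℤ) (h : ∀ n, ψ (Pi.single n 1) = 0)
    (c : ℕ → ℤ) : ψ c = 0 := by
  have hcop (n : ℕ) : IsCoprime ((2 : ℤ) ^ n) (3 ^ n) :=
    IsCoprime.pow (by norm_num)
  choose a b hab using hcop
  have hc : c = (fun n => 2 ^ n * (a n * c n)) + fun n => 3 ^ n * (b n * c n) := by
    funext n
    simp only [Pi.add_apply]
    linear_combination -c n * hab n
  rw [hc, map_add,
    map_eq_zero_of_pow_dvd ψ h (p := 2) (by norm_num) fun n => dvd_mul_right _ _,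
    map_eq_zero_of_pow_dvd ψ h (p := 3) (by norm_num) fun n => dvd_mul_right _ _, add_zero]

/-- Specker's theorem, second half: a homomorphism `ℤ^ℕ → ℤ` vanishes on some unit vector.
Otherwise a suitable rapidly divisible sequence `d` would make `E ↦ ψ (d restricted to E)` an
injection from the uncountable set of subsets of `ℕ` into `ℤ`. -/
theorem exists_map_single_eq_zero (ψ : (ℕ → ℤ) →+ ℤ) : ∃ n, ψ (Pi.single n 1) = 0 := by
  classical
  by_contra! hs
  set s : ℕ → ℤ := fun n => ψ (Pi.single n 1) with hs_def
  set d : ℕ → ℤ := fun n => ∏ i ∈ Finset.range n, (2 * s i) with hd_def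
  have hd0 (n : ℕ) : d n ≠ 0 :=
    Finset.prod_ne_zero_iff.2 fun i _ => mul_ne_zero two_ne_zero (hs i)
  have hdvd {m n : ℕ} (h : m ≤ n) : d m ∣ d n :=
    Finset.prod_dvd_prod_of_subset _ _ _ (by simpa using h)
  refine Function.cantor_injective
    (fun E : Set ℕ => Encodable.encode (ψ (E.indicator d))) fun E E' hEE => ?_
  have hψ : ψ (E.indicator d - E'.indicator d) = 0 := by
    rw [map_sub, Encodable.encode_injective hEE, sub_self]
  by_contra hne
  have hex : ∃ n, ¬(n ∈ E ↔ n ∈ E') := by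
    by_contra! h
    exact hne (Set.ext h)
  -- At the first difference `n`, divisibility by `d (n + 1) = d n * (2 * s n)` is violated.
  set n := Nat.find hex
  have hn : ¬(n ∈ E ↔ n ∈ E') := Nat.find_spec hex
  have hlt (i : ℕ) (hi : i < n) : (E.indicator d - E'.indicator d) i = 0 := by
    have := not_not.1 (Nat.find_min hex hi)
    by_cases hE : i ∈ E
    · simp [hE, this.1 hE]
    · simp [hE, mt this.2 hE]
  have hc (i : ℕ) (hi : n + 1 ≤ i) : d (n + 1) ∣ (E.indicator d - E'.indicator d) i := by
    simp only [Pi.sub_apply, Set.indicator_apply]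
    refine dvd_sub ?_ ?_ <;> split_ifs <;> first | exact hdvd hi | exact dvd_zero _
  have key := dvd_map_sub_sum ψ hc
  rw [hψ, Finset.sum_range_succ, Finset.sum_eq_zero fun i hi => by
    rw [hlt i (Finset.mem_range.1 hi), zero_mul]] at key
  have key' : d (n + 1) ∣ d n * s n := by
    by_cases hE : n ∈ E
    · have hE' : n ∉ E' := fun h => hn ⟨fun _ => h, fun _ => hE⟩
      simpa [hE, hE', hs_def] using key
    · have hE' : n ∈ E' := by
        by_contra h
        exact hn ⟨fun h' => (hE h').elim, fun h' => (h h').elim⟩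
      simpa [hE, hE', hs_def] using key
  have hsucc : d (n + 1) = d n * s n * 2 := by
    simp only [hd_def, Finset.prod_range_succ]
    ring
  rw [hsucc] at key'
  have h2 := Int.isUnit_iff.1 (isUnit_of_dvd_one
    ((mul_dvd_mul_iff_left (mul_ne_zero (hd0 n) (hs n))).1 (by simpa using key')))
  omega

/-! ### The ultrafilter attached to a homomorphism `ℤ^I → ℤ` -/

/-- The homomorphism `ℤ^ℕ → ℤ` induced by `φ`, a partition `p : I → ℕ` and a function `g`; it sends
the `n`-th unit vector to the value of `φ` at the restriction of `g` to the `n`-th part. -/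
def homOfPartition {I : Type*} (φ : (I → ℤ) →+ ℤ) (p : I → ℕ) (g : I → ℤ) : (ℕ → ℤ) →+ ℤ :=
  φ.comp
    { toFun := fun c i => c (p i) * g i
      map_zero' := by funext i; simp
      map_add' := fun c c' => by funext i; simp [add_mul] }

theorem homOfPartition_single {I : Type*} (φ : (I → ℤ) →+ ℤ) (p : I → ℕ) (g : I → ℤ) (n : ℕ) :
    homOfPartition φ p g (Pi.single n 1) = φ ((p ⁻¹' {n}).indicator g) := by
  refine congrArg φ (funext fun i => ?_)
  by_cases h : p i = n <;> simp [h]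

theorem homOfPartition_one {I : Type*} (φ : (I → ℤ) →+ ℤ) (p : I → ℕ) (g : I → ℤ) :
    homOfPartition φ p g 1 = φ g :=
  congrArg φ (funext fun i => by simp)

/-- A set `A ⊆ I` is null for `φ : ℤ^I → ℤ` if `φ` vanishes on all functions supported in `A`. -/
def IsNullFor {I : Type*} (φ : (I → ℤ) →+ ℤ) (A : Set I) : Prop :=
  ∀ f : I → ℤ, φ (A.indicator f) = 0

namespace IsNullFor

variable {I : Type*} {φ : (I → ℤ) →+ ℤ}

theorem mono {A B : Set I} (hB : IsNullFor φ B) (h : A ⊆ B) : IsNullFor φ A := fun f => by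
  rw [← Set.inter_eq_right.2 h, ← Set.indicator_indicator]
  exact hB _

theorem empty : IsNullFor φ ∅ := fun f => by
  rw [Set.indicator_empty]
  exact map_zero φ

/-- Every countable partition `p` of `I` has a null part: the second half of Specker's theorem,
applied to functions supported in the parts. -/
theorem exists_fiber (φ : (I → ℤ) →+ ℤ) (p : I → ℕ) : ∃ n, IsNullFor φ (p ⁻¹' {n}) := by
  by_contra! h
  simp only [IsNullFor, not_forall] at h
  choose f hf using h
  obtain ⟨n, hn⟩ := exists_map_single_eq_zero (homOfPartition φ p fun i => f (p i) i)
  refine hf n ?_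
  rw [← hn, homOfPartition_single]
  refine congrArg φ (funext fun i => ?_)
  by_cases h : p i = n <;> simp [h]

/-- The null sets form a `σ`-ideal, by the first half of Specker's theorem. -/
theorem iUnion {A : ℕ → Set I} (hA : ∀ n, IsNullFor φ (A n)) : IsNullFor φ (⋃ n, A n) := by
  intro f
  set g := (⋃ n, A n).indicator f
  -- Outside `⋃ n, A n`, where `p` takes the junk value `0`, the function `g` vanishes.
  let p : I → ℕ := fun i => sInf {n | i ∈ A n}
  rw [← homOfPartition_one φ p g]
  refine map_eq_zero_of_map_single_eq_zero _ (fun n => ?_) _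
  rw [homOfPartition_single, ← hA n ((p ⁻¹' {n}).indicator g)]
  refine congrArg φ (Set.indicator_eq_self.2 fun i hi => ?_).symm
  obtain ⟨rfl, hig⟩ : p i = n ∧ g i ≠ 0 := by simpa using hi
  exact Nat.sInf_mem (s := {n | i ∈ A n})
    (Set.mem_iUnion.1 (Set.mem_of_indicator_ne_zero (f := f) hig))

theorem union {A B : Set I} (hA : IsNullFor φ A) (hB : IsNullFor φ B) : IsNullFor φ (A ∪ B) :=
  (iUnion (A := fun n => if n = 0 then A else B)
    fun n => by split_ifs <;> assumption).mono <|
      Set.union_subset (Set.subset_iUnion_of_subset 0 (by simp))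
        (Set.subset_iUnion_of_subset 1 (by simp))

/-- If `φ ≠ 0`, some non-null set cannot be split into two non-null sets: otherwise repeated
splitting would produce a partition of `I` into infinitely many non-null sets. -/
theorem exists_atom (hφ : φ ≠ 0) :
    ∃ A, ¬IsNullFor φ A ∧ ∀ B, IsNullFor φ (A ∩ B) ∨ IsNullFor φ (A \ B) := by
  by_contra! h
  have huniv : ¬IsNullFor φ Set.univ := fun hn => hφ <| AddMonoidHom.ext fun f => by
    simpa using hn f
  choose! D hD hD' using h
  let C : ℕ → Set I := fun n => Nat.rec Set.univ (fun _ A => A ∩ D A) n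
  have hC (n : ℕ) : ¬IsNullFor φ (C n) := by
    induction n with
    | zero => exact huniv
    | succ n ih => exact hD _ ih
  have hanti : Antitone C := antitone_nat_of_succ_le fun n => Set.inter_subset_left
  -- The part with index `n` contains `C n \ C (n + 1)`; points lying in every `C n` have index `0`,
  -- which only enlarges that part.
  obtain ⟨n, hn⟩ := exists_fiber φ fun i => sInf {n | i ∉ C (n + 1)}
  refine hD' _ (hC n) (hn.mono fun i hi => ?_)
  have hi' : i ∉ C (n + 1) := fun h => hi.2 h.2
  refine le_antisymm (Nat.sInf_le hi') (le_csInf ⟨n, hi'⟩ fun m hm => ?_)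
  by_contra! hlt
  exact hm (hanti hlt hi.1)

end IsNullFor

/-- A nonzero homomorphism `ℤ^I → ℤ` which depends only on values modulo `F` yields an
`ω₁`-complete ultrafilter extending `F`, namely the sets that are co-null inside an atom of the null
ideal. -/
theorem exists_ultrafilter_of_addMonoidHom {I : Type u} {F : Filter I} {φ : (I → ℤ) →+ ℤ}
    (hφ : φ ≠ 0) (hF : ∀ f : I → ℤ, f =ᶠ[F] 0 → φ f = 0) :
    ∃ U : Ultrafilter I, (U : Filter I) ≤ F ∧ CardinalInterFilter (U : Filter I) ℵ₁ := by
  obtain ⟨A, hA, hsplit⟩ := IsNullFor.exists_atom hφ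
  let G : Filter I := Filter.ofCountableInter {B | IsNullFor φ (A \ B)}
    (fun S hS hSG => by
      rcases S.eq_empty_or_nonempty with rfl | hne
      · simpa using IsNullFor.empty
      · obtain ⟨B, rfl⟩ := hS.exists_eq_range hne
        have : A \ ⋂₀ Set.range B = ⋃ n, A \ B n := by
          rw [Set.sInter_range, Set.sdiff_iInter]
        change IsNullFor φ (A \ _)
        rw [this]
        exact IsNullFor.iUnion fun n => hSG ⟨n, rfl⟩)
    (fun B C hB hBC => hB.mono (Set.sdiff_subset_sdiff_right hBC))
  have hG (B : Set I) : B ∈ G ↔ IsNullFor φ (A \ B) := Iff.rfl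
  have hcount : CountableInterFilter G := inferInstance
  refine ⟨Ultrafilter.ofComplNotMemIff G fun B => ?_, fun B hB => ?_,
    cardinalInterFilter_aleph_one_iff.2 hcount⟩
  · rw [hG, hG, sdiff_compl]
    refine ⟨(hsplit B).resolve_left, fun h h' => hA ?_⟩
    rw [← Set.inter_union_sdiff A B]
    exact h'.union h
  · refine (hG B).2 fun f => hF _ ?_
    filter_upwards [hB] with i hi
    exact Set.indicator_of_notMem (fun h => h.2 hi) f

/-! ### From linear equations to ultrafilters -/

theorem isSolution_pi_eval {I : Type*} (T : Set ((I → ℤ) →₀ ℤ)) {i : I}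
    (h : ∀ k ∈ T, (k.sum fun g a => a • g) i = 0) : IsSolution T fun g : I → ℤ => g i := by
  intro k hk
  simpa [Finsupp.sum, Finset.sum_apply] using h k hk

/-- The system attached to a filter `F` on `I`: its variables are the functions `I → ℤ`, and its
equations are the nontrivial `ℤ`-linear relations modulo `F` among functions which are not zero
modulo `F`. The functions that are zero modulo `F` must not appear as variables: an equation in
them alone could have no weakly nontrivial solution. -/
def relationSystem {I : Type u} (F : Filter I) : Set (HomEquation (I → ℤ)) :=
  {k | k ≠ 0 ∧ (∀ g ∈ k.support, ¬g =ᶠ[F] 0) ∧ (k.sum fun g a => a • g) =ᶠ[F] 0}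

theorem relationSystem_nonempty {I : Type u} (F : Filter I) [F.NeBot] :
    (relationSystem F).Nonempty := by
  have hne : (fun _ : I => (1 : ℤ)) ≠ fun _ => 2 := by
    intro h
    obtain ⟨i⟩ := F.nonempty_of_neBot
    simpa using congrFun h i
  refine ⟨Finsupp.single (fun _ => 1) 2 - Finsupp.single (fun _ => 2) 1, ?_, ?_, ?_⟩
  · intro h
    simpa [Finsupp.single_apply, hne.symm] using DFunLike.congr_fun h fun _ => 1
  · intro g hg h0
    rw [Finsupp.mem_support_iff] at hg
    have : g = (fun _ => 1) ∨ g = fun _ => 2 := by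
      by_contra! hcon
      exact hg (by simp [hcon.1.symm, hcon.2.symm])
    obtain ⟨i, hi⟩ := h0.exists
    rcases this with rfl | rfl <;> simp at hi
  · refine Eventually.of_forall fun i => ?_
    rw [Finsupp.sum_sub_index (by intros; rw [sub_smul])]
    simp

/-- A small subsystem is solved by evaluation at a point `i`: by `κ`-completeness all its relations
hold at `F`-almost every `i`, and a variable which is not zero modulo `F` is nonzero at one of these
points. -/
theorem weaklyNontriviallySolvable_of_subset_relationSystem {κ : Cardinal.{u}} {I : Type u}
    {F : Filter I} [CardinalInterFilter F κ] {T : Set (HomEquation (I → ℤ))}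
    (hT : T ⊆ relationSystem F) (hne : T.Nonempty) (hcard : #T < κ) :
    WeaklyNontriviallySolvable ℤ T := by
  have hev : ∀ᶠ i in F, ∀ k ∈ T, (k.sum fun g a => a • g) i = 0 :=
    (eventually_cardinal_ball hcard).2 fun k hk => (hT hk).2.2
  obtain ⟨k, hk⟩ := hne
  obtain ⟨g, hg⟩ := Finsupp.support_nonempty_iff.2 (hT hk).1
  have hfreq : ∃ᶠ i in F, g i ≠ 0 := fun h =>
    (hT hk).2.1 g hg (h.mono fun i hi => not_not.1 hi)
  obtain ⟨i, hi, hsol⟩ := (hfreq.and_eventually hev).exists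
  exact ⟨fun g => g i, isSolution_pi_eval T hsol, fun _ => ⟨g, ⟨k, hk, hg⟩, hi⟩⟩

/-- A solution of the system attached to `F`, changed to be `0` at the functions vanishing modulo
`F`, respects all relations modulo `F`. -/
theorem sum_smul_eq_zero_of_isSolution {I : Type u} {F : Filter I} {f φ : (I → ℤ) → ℤ}
    (hf : IsSolution (relationSystem F) f) (hφ₀ : ∀ g, g =ᶠ[F] 0 → φ g = 0)
    (hφ : ∀ g, ¬g =ᶠ[F] 0 → φ g = f g) {k : (I → ℤ) →₀ ℤ}
    (hk : (k.sum fun g a => a • g) =ᶠ[F] 0) : (k.sum fun g a => a • φ g) = 0 := by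
  classical
  -- Discard the variables that vanish modulo `F`.
  set k' := k.filter fun g => ¬g =ᶠ[F] 0 with hk'
  have hsum : (k'.sum fun g a => a • g) =ᶠ[F] 0 := by
    have h0 : ((k.filter fun g => ¬¬g =ᶠ[F] 0).sum fun g a => a • g) =ᶠ[F] 0 := by
      rw [Finsupp.sum]
      refine Finset.sum_induction _ (fun g => g =ᶠ[F] 0)
        (fun a b ha hb => by simpa using ha.add hb) EventuallyEq.rfl fun g hg => ?_
      have hg0 : g =ᶠ[F] 0 := by
        rw [Finsupp.support_filter, Finset.mem_filter] at hg
        exact not_not.1 hg.2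
      filter_upwards [hg0] with i hi
      simp [hi]
    have hadd : (k.sum fun g a => a • g) = (k'.sum fun g a => a • g) +
        (k.filter fun g => ¬¬g =ᶠ[F] 0).sum fun g a => a • g := by
      rw [hk', ← Finsupp.sum_add_index' (by simp) (by intros; rw [add_smul]),
        Finsupp.filter_add_filter_not]
    filter_upwards [hk, h0] with i hi hi0
    rwa [hadd, Pi.add_apply, hi0, Pi.zero_apply, add_zero] at hi
  have hφsum : (k.sum fun g a => a • φ g) = k'.sum fun g a => a • f g := by
    rw [Finsupp.sum, Finsupp.sum, hk', Finsupp.support_filter, Finset.sum_filter]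
    refine Finset.sum_congr rfl fun g _ => ?_
    by_cases hg : g =ᶠ[F] 0
    · simp [hg, hφ₀ g hg]
    · simp [hg, hφ g hg]
  rw [hφsum]
  by_cases h0 : k' = 0
  · simp [h0]
  · refine hf k' ⟨h0, fun g hg => ?_, hsum⟩
    rw [hk', Finsupp.support_filter, Finset.mem_filter] at hg
    exact hg.2

theorem IsLCompact.of_inWS {κ : Cardinal.{u}} (h : InWS κ) : IsLCompact ℵ₁ κ := by
  classical
  intro I F hF hFκ
  obtain ⟨f, hf, hnt⟩ := h (I → ℤ) (relationSystem F) (relationSystem_nonempty F)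
    fun T hT hne hcard => weaklyNontriviallySolvable_of_subset_relationSystem hT hne hcard
  obtain ⟨g, ⟨k, hk, hgk⟩, hg⟩ := hnt (relationSystem_nonempty F)
  let φ : (I → ℤ) → ℤ := fun g => if g =ᶠ[F] 0 then 0 else f g
  have hφ₀ (g : I → ℤ) (hg : g =ᶠ[F] 0) : φ g = 0 := if_pos hg
  have hφ (g : I → ℤ) (hg : ¬g =ᶠ[F] 0) : φ g = f g := if_neg hg
  have hadd (a b : I → ℤ) : φ (a + b) = φ a + φ b := by
    have := sum_smul_eq_zero_of_isSolution hf hφ₀ hφ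
      (k := Finsupp.single a 1 + Finsupp.single b 1 + Finsupp.single (a + b) (-1)) (by
        refine EventuallyEq.of_eq ?_
        rw [Finsupp.sum_add_index' (by simp) (by intros; rw [add_smul]),
          Finsupp.sum_add_index' (by simp) (by intros; rw [add_smul])]
        simp only [Finsupp.sum_single_index, zero_smul, one_smul, neg_smul]
        exact add_neg_cancel _)
    rw [Finsupp.sum_add_index' (by simp) (by intros; rw [add_smul]),
      Finsupp.sum_add_index' (by simp) (by intros; rw [add_smul])] at this
    simp only [Finsupp.sum_single_index, zero_smul, one_smul, neg_smul] at this
    linarith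
  refine exists_ultrafilter_of_addMonoidHom (φ := AddMonoidHom.mk' φ hadd) (fun h0 => hg ?_) hφ₀
  rw [← hφ g (hk.2.1 g hgk)]
  exact DFunLike.congr_fun h0 g

/-! ### From ultrafilters to linear equations -/

theorem IsLCompact.mono {ν κ κ' : Cardinal.{u}} (h : IsLCompact ν κ) (hle : κ ≤ κ') :
    IsLCompact ν κ' := fun I F hF _ =>
  h I F hF (CardinalInterFilter.of_cardinalInterFilter_of_le F hle)

theorem InWS.mono {κ κ' : Cardinal.{u}} (h : InWS κ) (hle : κ ≤ κ') : InWS κ' :=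
  fun X S hS hT => h X S hS fun T hTS hne hcard => hT T hTS hne (hcard.trans_le hle)

/-- The cofinite filter on a countably infinite set has no `ω₁`-complete ultrafilter extending
it. -/
theorem not_isLCompact_aleph0 : ¬IsLCompact ℵ₁ (ℵ₀ : Cardinal.{u}) := by
  intro h
  obtain ⟨U, hU, hc⟩ := h (ULift.{u} ℕ) cofinite inferInstance (cardinalInterFilter_aleph0 _)
  have := cardinalInterFilter_aleph_one_iff.1 hc
  have hev : ∀ᶠ n in (U : Filter (ULift.{u} ℕ)), ∀ m, n ≠ m :=
    eventually_countable_forall.2 fun m => hU (Set.finite_singleton m).compl_mem_cofinite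
  obtain ⟨n, hn⟩ := hev.exists
  exact hn n rfl

theorem IsLCompact.aleph0_lt {κ : Cardinal.{u}} (h : IsLCompact ℵ₁ κ) : ℵ₀ < κ :=
  not_le.1 fun hle => not_isLCompact_aleph0 (h.mono hle)

/-- The subsets of `S` of cardinality less than `κ`, ordered by inclusion. -/
abbrev SmallSubset {α : Type u} (κ : Cardinal.{u}) (S : Set α) : Type u :=
  {T : Set α // T ⊆ S ∧ #T < κ}

theorem nonempty_smallSubset {α : Type u} {κ : Cardinal.{u}} (hκ : κ.IsRegular) (S : Set α) :
    Nonempty (SmallSubset κ S) :=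
  ⟨∅, Set.empty_subset _, by simpa using hκ.pos⟩

theorem isDirectedOrder_smallSubset {α : Type u} {κ : Cardinal.{u}} (hκ : κ.IsRegular)
    (S : Set α) : IsDirectedOrder (SmallSubset κ S) :=
  ⟨fun A B => ⟨⟨A.1 ∪ B.1, Set.union_subset A.2.1 B.2.1,
    (mk_union_le _ _).trans_lt (add_lt_of_lt hκ.aleph0_le A.2.2 B.2.2)⟩,
    Set.subset_union_left, Set.subset_union_right⟩⟩

theorem cardinalInterFilter_atTop_smallSubset {α : Type u} {κ : Cardinal.{u}} (hκ : κ.IsRegular)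
    (S : Set α) : CardinalInterFilter (atTop : Filter (SmallSubset κ S)) κ := by
  have := nonempty_smallSubset hκ S
  have := isDirectedOrder_smallSubset hκ S
  refine ⟨fun 𝒜 hcard h𝒜 => ?_⟩
  simp only [mem_atTop_sets] at h𝒜 ⊢
  choose! B hB using h𝒜
  refine ⟨⟨⋃ A : 𝒜, (B A).1, Set.iUnion_subset fun A => (B A).2.1,
    (card_iUnion_lt_iff_forall_of_isRegular hκ hcard).2 fun A => (B A).2.2⟩, fun T hT A hA => ?_⟩
  exact hB A hA T ((Set.subset_iUnion (fun A : 𝒜 => (B A).1) ⟨A, hA⟩).trans hT)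

/-- If all small subsystems of `S` have weakly nontrivial solutions, then a single variable witnesses
this for all of them. Otherwise every variable of `S` is forced to be zero by a small subsystem, and
closing off under these gives a small subsystem that forces all of its own variables to be zero. -/
theorem exists_variable_ne_zero {κ : Cardinal.{u}} (hκ : κ.IsRegular) (hκ₀ : ℵ₀ < κ) {X : Type u}
    {S : Set (HomEquation X)} (hS : S.Nonempty)
    (h : ∀ T ⊆ S, T.Nonempty → #T < κ → WeaklyNontriviallySolvable ℤ T) :
    ∃ x ∈ variablesOf S, ∀ T ⊆ S, #T < κ → ∃ f : X → ℤ, IsSolution T f ∧ f x ≠ 0 := by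
  by_contra! hcon
  choose! Z hZS hZcard hZ using hcon
  obtain ⟨k₀, hk₀⟩ := hS
  let E : HomEquation X → Set (HomEquation X) := fun k => ⋃ x : k.support, Z x
  let C : ℕ → Set (HomEquation X) :=
    fun n => Nat.rec {k₀} (fun _ T => ⋃ k : T, E k) n
  have hC (n : ℕ) : C n ⊆ S ∧ #↥(C n) < κ := by
    induction n with
    | zero =>
      exact ⟨by simpa [C] using hk₀, by simpa [C] using one_lt_aleph0.trans hκ₀⟩
    | succ n ih =>
      have hvar (k : C n) (x : k.1.support) : x.1 ∈ variablesOf S :=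
        ⟨k.1, ih.1 k.2, x.2⟩
      refine ⟨Set.iUnion_subset fun k => Set.iUnion_subset fun x => hZS x (hvar k x), ?_⟩
      refine (card_iUnion_lt_iff_forall_of_isRegular hκ ih.2).2 fun k => ?_
      exact (card_iUnion_lt_iff_forall_of_isRegular hκ ((mk_lt_aleph0).trans hκ₀)).2
        fun x => hZcard x (hvar k x)
  let T : Set (HomEquation X) := ⋃ n : ULift.{u} ℕ, C n.down
  have hTS : T ⊆ S := Set.iUnion_subset fun n => (hC n.down).1
  have hTne : T.Nonempty := ⟨k₀, Set.mem_iUnion.2 ⟨⟨0⟩, rfl⟩⟩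
  have hTcard : #T < κ := (card_iUnion_lt_iff_forall_of_isRegular hκ (by simpa using hκ₀)).2
    fun n => (hC n.down).2
  obtain ⟨f, hf, hnt⟩ := h T hTS hTne hTcard
  obtain ⟨x, ⟨k, hk, hx⟩, hfx⟩ := hnt hTne
  obtain ⟨n, hn⟩ := Set.mem_iUnion.1 hk
  refine hfx (hZ x ⟨k, hTS hk, hx⟩ f fun k' hk' => hf k' ?_)
  exact Set.mem_iUnion.2 ⟨⟨n.down + 1⟩, Set.mem_iUnion.2 ⟨⟨k, hn⟩,
    Set.mem_iUnion.2 ⟨⟨x, hx⟩, hk'⟩⟩⟩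

theorem Ultrafilter.exists_eventually_eq_of_countable {I Y : Type*} [Countable Y]
    (U : Ultrafilter I) [CountableInterFilter (U : Filter I)] (f : I → Y) :
    ∃ y, ∀ᶠ i in (U : Filter I), f i = y := by
  by_contra h
  have hev : ∀ᶠ i in (U : Filter I), ∀ y, f i ≠ y :=
    eventually_countable_forall.2 fun y => Ultrafilter.eventually_not.2 fun hy => h ⟨y, hy⟩
  obtain ⟨i, hi⟩ := hev.exists
  exact hi _ rfl

/-- The limit, along an `ω₁`-complete ultrafilter on the small subsystems, of solutions that do not
vanish at a common variable is a weakly nontrivial solution of the whole system. -/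
theorem InWS.of_isLCompact_of_isRegular {κ : Cardinal.{u}} (hκ : κ.IsRegular)
    (h : IsLCompact ℵ₁ κ) : InWS κ := by
  intro X S hS hT
  obtain ⟨x₀, hx₀, hsol⟩ := exists_variable_ne_zero hκ h.aleph0_lt hS hT
  let J := SmallSubset κ S
  have := nonempty_smallSubset hκ S
  have := isDirectedOrder_smallSubset hκ S
  obtain ⟨U, hU, hUc⟩ := h J atTop inferInstance (cardinalInterFilter_atTop_smallSubset hκ S)
  have := cardinalInterFilter_aleph_one_iff.1 hUc
  have hsol' (T : J) := hsol T.1 T.2.1 T.2.2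
  choose s hs hs₀ using hsol'
  choose f hf using fun x => U.exists_eventually_eq_of_countable fun T => s T x
  refine ⟨f, fun k hk => ?_, fun _ => ⟨x₀, hx₀, ?_⟩⟩
  · have hmem : ∀ᶠ T : J in (U : Filter J), k ∈ T.1 := by
      have hk1 : #({k} : Set (HomEquation X)) < κ := by
        simpa using one_lt_aleph0.trans h.aleph0_lt
      refine hU (mem_of_superset (mem_atTop ⟨{k}, by simpa using hk, hk1⟩) fun T hT => ?_)
      exact hT rfl
    have hlim : ∀ᶠ T : J in (U : Filter J), ∀ x ∈ k.support, s T x = f x :=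
      (eventually_all_finset _).2 fun x _ => hf x
    obtain ⟨T, hkT, hTlim⟩ := (hmem.and hlim).exists
    rw [← hs T k hkT]
    exact Finset.sum_congr rfl fun x hx => congrArg (k x • ·) (hTlim x hx).symm
  · obtain ⟨T, hT⟩ := (hf x₀).exists
    exact hT ▸ hs₀ T

theorem InWS.of_isLCompact {κ : Cardinal.{u}}
    (hκ : ¬(κ.IsSingular ∧ IsLeast {μ : Cardinal.{u} | IsLCompact ℵ₁ μ} κ))
    (h : IsLCompact ℵ₁ κ) : InWS κ := by
  rcases isRegular_or_isSingular h.aleph0_lt.le with hreg | hsing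
  · exact of_isLCompact_of_isRegular hreg h
  · have hlt : ∃ μ, IsLCompact ℵ₁ μ ∧ μ < κ := by
      by_contra! hle
      exact hκ ⟨hsing, h, fun μ hμ => hle μ hμ⟩
    obtain ⟨μ, hμ, hμκ⟩ := hlt
    exact (of_isLCompact_of_isRegular (isRegular_succ hμ.aleph0_lt.le)
      (hμ.mono (Order.le_succ μ))).mono (Order.succ_le_of_lt hμκ)

theorem theoremt (κ : Cardinal.{u})
    (hκ : ¬ (κ.IsSingular ∧ IsLeast {μ : Cardinal.{u} | IsLCompact ℵ₁ μ} κ)) :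
    IsLCompact ℵ₁ κ ↔ InWS κ :=
  ⟨InWS.of_isLCompact hκ, IsLCompact.of_inWS⟩
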